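/- **Theorem (1-monodromy classification).** Let $X$ be a topological space which is locally relatively 1-connected: each point of $X$ has a fundamental system of arcwise connected neighbourhoods $U$ such that each loop in $U$ is homotopic in $X$ to a constant path. For a category $\mathcal C$ let $\mathcal C_X$ be the constant stack on $X$ with stalk $\mathcal C$ (the stack associated to the constant prestack $U\mapsto\mathcal C$), let $\Gamma(X,\mathcal C_X)$ be its category of global sections (the local systems on $X$ with values in $\mathcal C$), and let $\Pi_1(X)$ be the Poincaré groupoid of $X$ (objects: the points of $X$; morphisms: homotopy classes of paths). Let $\omega_x$ denote the stalk functor at a point $x$, and for $I=[0,1]$ let $\eta_I\colon\mathcal C\to\Gamma(I,\mathcal C_I)$ be the equivalence sending an object to the corresponding constant local system. The monodromy functor $$\mu_{X,\mathcal C}\colon \Gamma(X,\mathcal C_X)\longrightarrow \operatorname{Hom}(\Pi_1(X),\mathcal C)$$ sends a local system $L$ to the functor $x\mapsto \omega_x(L)$ whose value on the class of a path $\gamma$ from $x$ to $y$ is the composite isomorphism $$\omega_x(L)\simeq\omega_0(\gamma^{-1}L)\simeq\eta_I^{-1}(\gamma^{-1}L)\simeq\omega_1(\gamma^{-1}L)\simeq\omega_y(L).$$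 Then for every category $\mathcal C$ the functor $\mu_{X,\mathcal C}$ is an equivalence of categories. Moreover the functors $\mu_{X,\mathcal C}$ form a 2-transformation $\mu_X$ from the 2-functor $\mathcal C\mapsto\Gamma(X,\mathcal C_X)$ to the 2-functor $\mathcal C\mapsto\operatorname{Hom}(\Pi_1(X),\mathcal C)$, and $\mu_X$ is an equivalence of 2-functors, i.e. it is invertible up to invertible modifications. -/

import Mathlib

open CategoryTheory TopologicalSpace Topology

universe v v' v'' w w' w'' u u'

/-- A local system on `X` with values in `C`: a global section over `X` of the constant stack with
stalk `C`, i.e. of the stack associated to the constant prestack `U ↦ C`.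

The separated prestack associated to the constant prestack has the objects of `C` as its objects
over any open set, and locally constant functions with values in `M ⟶ N` as its morphisms
`M ⟶ N`. A section of the associated stack is a descent datum for it on some open cover: an open
cover, an object of `C` on each member of the cover, and locally constant families of isomorphisms
on the overlaps satisfying the cocycle condition. Any open cover is refined by one of the form
`(U_x)` with `x ∈ U_x`, indexed by the points of `X`, and we take descent data on covers of this
form. The object on `U_x` is then also the stalk at `x`.

That `U ↦ LocalSystem U C` is indeed the stack associated to the constant prestack is
shown in the section on the constant stack below. -/
structure LocalSystem (X : Type u) [TopologicalSpace X] (C : Type w) [Category.{v} C] where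
  /-- the member `U_x` of the cover -/
  nhd : X → Opens X
  mem_nhd : ∀ x, x ∈ nhd x
  /-- the object `M_x` on `U_x` -/
  obj : X → C
  /-- the gluing isomorphism `M_x ≅ M_y` on `U_x ∩ U_y`, a locally constant family -/
  glue : ∀ x y, LocallyConstant ↥(nhd x ⊓ nhd y) (obj x ≅ obj y)
  cocycle : ∀ (x y z p : X) (hx : p ∈ nhd x) (hy : p ∈ nhd y) (hz : p ∈ nhd z),
    glue x y ⟨p, hx, hy⟩ ≪≫ glue y z ⟨p, hy, hz⟩ = glue x z ⟨p, hx, hz⟩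

namespace LocalSystem

section Basic

variable {X : Type u} [TopologicalSpace X] {C : Type w} [Category.{v} C]

/-- The identification of `M_x` with the stalk at a point `p` of `U_x`. -/
def frame (L : LocalSystem X C) (x : X) {p : X} (h : p ∈ L.nhd x) : L.obj x ≅ L.obj p :=
  L.glue x p ⟨p, h, L.mem_nhd p⟩

theorem frame_self (L : LocalSystem X C) (x : X) (h : x ∈ L.nhd x) :
    L.frame x h = Iso.refl _ := by
  have := L.cocycle x x x x h h h
  have h2 := congrArg (fun e => (L.frame x h).symm ≪≫ e) this
  simpa [frame] using h2

theorem frame_trans_symm (L : LocalSystem X C) (x y : X) {p : X} (hx : p ∈ L.nhd x)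
    (hy : p ∈ L.nhd y) : L.frame x hx ≪≫ (L.frame y hy).symm = L.glue x y ⟨p, hx, hy⟩ := by
  have := L.cocycle x y p p hx hy (L.mem_nhd p)
  simp only [frame]
  rw [← this]
  simp

theorem eventually_frame (L : LocalSystem X C) (x p : X) (hp : p ∈ L.nhd x) :
    ∀ᶠ q in 𝓝 p, ∀ (h : q ∈ L.nhd x) (h' : q ∈ L.nhd p),
      L.frame x h = L.frame x hp ≪≫ L.frame p h' := by
  have hl := (IsLocallyConstant.iff_eventually_eq _).1 (L.glue x p).isLocallyConstant
    ⟨p, hp, L.mem_nhd p⟩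
  have hm := (L.nhd x ⊓ L.nhd p).isOpen.isOpenEmbedding_subtypeVal.map_nhds_eq
    ⟨p, hp, L.mem_nhd p⟩
  have : ∀ᶠ q in 𝓝 p, ∀ h : q ∈ L.nhd x ⊓ L.nhd p, L.glue x p ⟨q, h⟩ = L.frame x hp := by
    change ∀ᶠ q in 𝓝 (Subtype.val (⟨p, hp, L.mem_nhd p⟩ : ↥(L.nhd x ⊓ L.nhd p))), _
    rw [← hm, Filter.eventually_map]
    filter_upwards [hl] with q hq _
    exact hq
  filter_upwards [this] with q hq h h'
  rw [← hq ⟨h, h'⟩, ← frame_trans_symm L x p h h']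
  simp

/-- A morphism of local systems: a family of morphisms between the stalks which near each point
`x` comes from one constant morphism `M_x ⟶ M'_x`, in the frames at `x`. This is a global section,
given by its germs, of the sheaf associated to the presheaf of morphisms between the two descent
data. By `Hom.isLocallyConstant` below it is the same as a compatible family of locally constant
functions from `U_x ∩ U'_x` to `M_x ⟶ M'_x`. -/
@[ext]
structure Hom (L L' : LocalSystem X C) where
  app : ∀ x, L.obj x ⟶ L'.obj x
  eventually_app : ∀ x, ∀ᶠ p in 𝓝 x, ∀ (h : p ∈ L.nhd x) (h' : p ∈ L'.nhd x),
    (L.frame x h).hom ≫ app p = app x ≫ (L'.frame x h').hom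

instance : Category.{max u v} (LocalSystem X C) where
  Hom := Hom
  id L := ⟨fun x => 𝟙 _, fun x => .of_forall fun p h h' => by simp⟩
  comp {L L' L''} φ ψ := ⟨fun x => φ.app x ≫ ψ.app x, fun x => by
    filter_upwards [φ.eventually_app x, ψ.eventually_app x,
      (L'.nhd x).isOpen.mem_nhds (L'.mem_nhd x)] with p h1 h2 h3 h h'
    rw [← Category.assoc, h1 h h3, Category.assoc, h2 h3 h', Category.assoc]⟩

@[ext]
theorem hom_ext {L L' : LocalSystem X C} {φ ψ : L ⟶ L'} (h : ∀ x, φ.app x = ψ.app x) : φ = ψ :=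
  Hom.ext (funext h)

@[simp] theorem id_app (L : LocalSystem X C) (x : X) : Hom.app (𝟙 L) x = 𝟙 (L.obj x) := rfl

@[simp] theorem comp_app {L L' L'' : LocalSystem X C} (φ : L ⟶ L') (ψ : L' ⟶ L'') (x : X) :
    Hom.app (φ ≫ ψ) x = φ.app x ≫ ψ.app x := rfl

/-- In the frames at `x`, a morphism is a locally constant function on all of `U_x ∩ U'_x`. -/
theorem Hom.isLocallyConstant {L L' : LocalSystem X C} (φ : L ⟶ L') (x : X) :
    IsLocallyConstant fun p : ↥(L.nhd x ⊓ L'.nhd x) =>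
      (L.frame x p.2.1).hom ≫ φ.app p ≫ (L'.frame x p.2.2).inv := by
  rw [IsLocallyConstant.iff_eventually_eq]
  rintro ⟨p, hp, hp'⟩
  have h1 : ∀ᶠ q : ↥(L.nhd x ⊓ L'.nhd x) in 𝓝 ⟨p, hp, hp'⟩, q.1 ∈ L.nhd p ⊓ L'.nhd p :=
    continuous_subtype_val.continuousAt ((L.nhd p ⊓ L'.nhd p).isOpen.mem_nhds
      ⟨L.mem_nhd p, L'.mem_nhd p⟩)
  filter_upwards [h1, continuous_subtype_val.continuousAt (φ.eventually_app p),
    continuous_subtype_val.continuousAt (L.eventually_frame x p hp),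
    continuous_subtype_val.continuousAt (L'.eventually_frame x p hp')] with q h1 h2 h3 h4
  have h2 : (L.frame p _).hom ≫ φ.app q = φ.app p ≫ (L'.frame p _).hom := h2 h1.1 h1.2
  have h3 : L.frame x _ = _ := h3 q.2.1 h1.1
  have h4 : L'.frame x _ = _ := h4 q.2.2 h1.2
  rw [h3, h4]
  simp [reassoc_of% h2]

/-- Isomorphisms of local systems are given stalkwise. -/
@[simps]
def isoMk {L L' : LocalSystem X C} (e : ∀ x, L.obj x ≅ L'.obj x)
    (h : ∀ x, ∀ᶠ p in 𝓝 x, ∀ (h : p ∈ L.nhd x) (h' : p ∈ L'.nhd x),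
      (L.frame x h).hom ≫ (e p).hom = (e x).hom ≫ (L'.frame x h').hom) : L ≅ L' where
  hom := ⟨fun x => (e x).hom, h⟩
  inv := ⟨fun x => (e x).inv, fun x => by
    filter_upwards [h x] with p hp h h'
    rw [Iso.eq_inv_comp, ← Category.assoc, ← hp h' h]
    simp⟩
  hom_inv_id := by ext x; simp
  inv_hom_id := by ext x; simp

theorem isIso_of_isIso_app' {L L' : LocalSystem X C} (φ : L ⟶ L') (h : ∀ x, IsIso (φ.app x)) :
    IsIso φ :=
  (isoMk (fun x => asIso (φ.app x)) φ.eventually_app).isIso_hom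

variable (X C) in
/-- The functor `η_X` sending an object of `C` to the constant local system with that stalk. -/
@[simps]
def unit : C ⥤ LocalSystem X C where
  obj M :=
    { nhd := fun _ => ⊤
      mem_nhd := fun _ => trivial
      obj := fun _ => M
      glue := fun _ _ => LocallyConstant.const _ (Iso.refl M)
      cocycle := fun _ _ _ _ _ _ _ => by simp }
  map f := ⟨fun _ => f, fun x => .of_forall fun p h h' => by simp [frame]⟩

variable (C) in
/-- The stalk functor `ω_x`. -/
@[simps]
def stalk (x : X) : LocalSystem X C ⥤ C where
  obj L := L.obj x
  map φ := φ.app x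

theorem unit_frame (M : C) (x : X) {p : X} (h : p ∈ ((unit X C).obj M).nhd x) :
    ((unit X C).obj M).frame x h = Iso.refl M := rfl

end Basic

section Functoriality

variable {X : Type u} [TopologicalSpace X] {Y : Type u'} [TopologicalSpace Y]
  {C : Type w} [Category.{v} C] 

/-- The inverse image `f⁻¹` of local systems under a continuous map. -/
@[simps]
def pullback (f : C(X, Y)) : LocalSystem Y C ⥤ LocalSystem X C where
  obj L :=
    { nhd := fun x => (L.nhd (f x)).comap f
      mem_nhd := fun x => L.mem_nhd (f x)
      obj := fun x => L.obj (f x)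
      glue := fun x y => (L.glue (f x) (f y)).comap
        ⟨fun p => ⟨f p.1, p.2⟩, by fun_prop⟩
      cocycle := fun x y z p hx hy hz => L.cocycle (f x) (f y) (f z) (f p) hx hy hz }
  map φ := ⟨fun x => φ.app (f x), fun x => f.continuous.continuousAt (φ.eventually_app (f x))⟩

theorem pullback_frame (f : C(X, Y)) (L : LocalSystem Y C) (x : X) {p : X}
    (h : p ∈ ((pullback f).obj L).nhd x) :
    ((pullback f).obj L).frame x h = L.frame (f x) (p := f p) h := rfl

variable {D : Type w'} [Category.{v'} D]

variable (X) in
/-- The functor on local systems induced by a functor of coefficient categories. -/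
@[simps]
def mapCoeff (F : C ⥤ D) : LocalSystem X C ⥤ LocalSystem X D where
  obj L :=
    { nhd := L.nhd
      mem_nhd := L.mem_nhd
      obj := fun x => F.obj (L.obj x)
      glue := fun x y => (L.glue x y).map F.mapIso
      cocycle := fun x y z p hx hy hz => by
        simp [← L.cocycle x y z p hx hy hz] }
  map φ := ⟨fun x => F.map (φ.app x), fun x => by
    filter_upwards [φ.eventually_app x] with p hp h h'
    have := congrArg F.map (hp h h')
    simpa [frame] using this⟩

variable (X) in
/-- The natural transformation induced by a natural transformation of coefficients. -/
@[simps]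
def mapCoeffNat {F G : C ⥤ D} (α : F ⟶ G) : mapCoeff X F ⟶ mapCoeff X G where
  app L := ⟨fun x => α.app (L.obj x), fun x => .of_forall fun p h _ =>
    α.naturality (L.frame x (p := p) h).hom⟩
  naturality _ _ φ := hom_ext fun x => α.naturality (φ.app x)

variable (X C) in
/-- Compatibility with identity functors. -/
def mapCoeffId : mapCoeff X (𝟭 C) ≅ 𝟭 (LocalSystem X C) :=
  NatIso.ofComponents
    (fun L => isoMk (L := (mapCoeff X (𝟭 C)).obj L) (L' := L) (fun x => Iso.refl (L.obj x))
      fun _ => .of_forall fun _ _ _ => (Category.comp_id _).trans (Category.id_comp _).symm)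
    (fun φ => hom_ext fun x => (Category.comp_id (φ.app x)).trans (Category.id_comp _).symm)

variable (X) in
/-- Compatibility with composition of functors. -/
def mapCoeffComp {E : Type w''} [Category.{v''} E] (F : C ⥤ D) (G : D ⥤ E) :
    mapCoeff X (F ⋙ G) ≅ mapCoeff X F ⋙ mapCoeff X G :=
  NatIso.ofComponents
    (fun L => isoMk (L := (mapCoeff X (F ⋙ G)).obj L)
      (L' := (mapCoeff X G).obj ((mapCoeff X F).obj L))
      (fun x => Iso.refl (G.obj (F.obj (L.obj x))))
      fun _ => .of_forall fun _ _ _ => (Category.comp_id _).trans (Category.id_comp _).symm)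
    (fun φ => hom_ext fun x =>
      (Category.comp_id (G.map (F.map (φ.app x)))).trans (Category.id_comp _).symm)

end Functoriality

section ConstantStack

/-! The presheaf of categories `U ↦ LocalSystem U C` is the stack associated to the constant
prestack with stalk `C`: it is a stack (`existsUnique_hom_of_cover`, `exists_of_descent`), its
sheaf of morphisms between constant objects is the sheaf of locally constant functions
(`homUnitEquiv`), and each of its sections is locally isomorphic to a constant one
(`restrictIsoUnit`). -/

variable {X : Type u} [TopologicalSpace X] {C : Type w} [Category.{v} C]

/-- The inclusion of open subsets as a continuous map. -/
def inclusion {U V : Opens X} (h : U ≤ V) : C(U, V) := ⟨Set.inclusion h, by fun_prop⟩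

variable (X) in
/-- The constant stack on `X` with stalk `C`. -/
def constantStack (C : Type w) [Category.{v} C] :
    (Opens X)ᵒᵖ ⥤ Cat.{max u v, max u v w} where
  obj U := Cat.of (LocalSystem U.unop C)
  map f := (pullback (C := C) (inclusion f.unop.le)).toCatHom
  map_id _ := rfl
  map_comp _ _ := rfl

/-- Restriction of a local system to an open subset. -/
abbrev restrict (U : Opens X) : LocalSystem X C ⥤ LocalSystem U C :=
  pullback ⟨Subtype.val, continuous_subtype_val⟩

/-- The sheaf of morphisms between constant local systems is the sheaf of locally constant
functions. -/
def homUnitEquiv (M N : C) : ((unit X C).obj M ⟶ (unit X C).obj N) ≃ LocallyConstant X (M ⟶ N) where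
  toFun φ := ⟨fun x => (show M ⟶ N from φ.app x), by
    refine (IsLocallyConstant.iff_eventually_eq _).2 fun x => ?_
    filter_upwards [φ.eventually_app x] with p hp
    exact (Category.id_comp _).symm.trans ((hp trivial trivial).trans (Category.comp_id _))⟩
  invFun f := ⟨fun x => f x, fun x => by
    filter_upwards [(IsLocallyConstant.iff_eventually_eq _).1 f.isLocallyConstant x] with p hp _ _
    exact (Category.id_comp _).trans (hp.trans (Category.comp_id _).symm)⟩
  left_inv _ := rfl
  right_inv _ := rfl

/-- A local system is locally isomorphic to a constant one. -/
def restrictIsoUnit (L : LocalSystem X C) (x : X) :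
    (unit (L.nhd x) C).obj (L.obj x) ≅ (restrict (L.nhd x)).obj L :=
  isoMk (fun p => L.frame x p.2) fun p => by
    filter_upwards [continuous_subtype_val.continuousAt (L.eventually_frame x p.1 p.2)] with q hq _ h'
    have hq : L.frame x _ = _ := hq q.2 h'
    exact (Category.id_comp _).trans (congrArg Iso.hom hq)

theorem eventually_of_subtype (U : Opens X) (x : U) {P : U → Prop} (h : ∀ᶠ p in 𝓝 x, P p) :
    ∀ᶠ p in 𝓝 x.1, ∀ hp : p ∈ U, P ⟨p, hp⟩ := by
  rw [nhds_subtype_eq_comap, Filter.eventually_comap] at h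
  filter_upwards [h] with p h hp
  exact h ⟨p, hp⟩ rfl

/-- Morphisms of local systems glue. -/
theorem existsUnique_hom_of_cover {ι : Type*} (V : ι → Opens X) (hV : ∀ x, ∃ i, x ∈ V i)
    (L L' : LocalSystem X C) (φ : ∀ i, (restrict (V i)).obj L ⟶ (restrict (V i)).obj L')
    (h : ∀ i j, (pullback (inclusion (inf_le_left : V i ⊓ V j ≤ V i))).map (φ i) =
      (pullback (inclusion (inf_le_right : V i ⊓ V j ≤ V j))).map (φ j)) :
    ∃! ψ : L ⟶ L', ∀ i, (restrict (V i)).map ψ = φ i := by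
  choose i hi using hV
  have key : ∀ j x (hx : x ∈ V j), (φ (i x)).app ⟨x, hi x⟩ = (φ j).app ⟨x, hx⟩ := fun j x hx =>
    congrArg (fun f => Hom.app f ⟨x, hi x, hx⟩) (h (i x) j)
  refine ⟨⟨fun x => (φ (i x)).app ⟨x, hi x⟩, fun x => ?_⟩, fun j => ?_, fun ψ hψ => ?_⟩
  · have h1 := (φ (i x)).eventually_app ⟨x, hi x⟩
    have h2 : ∀ᶠ p in 𝓝 x, ∀ hp : p ∈ V (i x), ∀ (h : p ∈ L.nhd x) (h' : p ∈ L'.nhd x),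
        (L.frame x h).hom ≫ (φ (i x)).app ⟨p, hp⟩ =
          (φ (i x)).app ⟨x, hi x⟩ ≫ (L'.frame x h').hom :=
      eventually_of_subtype _ _ h1
    filter_upwards [h2, (V (i x)).isOpen.mem_nhds (hi x)] with p h2 hp h h'
    exact (congrArg ((L.frame x h).hom ≫ ·) (key (i x) p hp)).trans (h2 hp h h')
  · exact hom_ext fun x => key j x.1 x.2
  · exact hom_ext fun x => congrArg (fun f => Hom.app f ⟨x, hi x⟩) (hψ (i x))

/-- A local system can be given by its frames. -/
@[simps nhd obj]
def ofFrame (nhd : X → Opens X) (mem_nhd : ∀ x, x ∈ nhd x) (obj : X → C)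
    (fr : ∀ (x : X) {p : X} (_ : p ∈ nhd x), obj x ≅ obj p)
    (h : ∀ x p (hp : p ∈ nhd x), ∀ᶠ q in 𝓝 p, ∀ (h : q ∈ nhd x) (h' : q ∈ nhd p),
      fr x h = fr x hp ≪≫ fr p h') : LocalSystem X C where
  nhd := nhd
  mem_nhd := mem_nhd
  obj := obj
  glue x y := ⟨fun p => fr x p.2.1 ≪≫ (fr y p.2.2).symm, by
    rw [IsLocallyConstant.iff_eventually_eq]
    rintro ⟨p, hx, hy⟩
    have hc : ContinuousAt (Subtype.val : ↥(nhd x ⊓ nhd y) → X) ⟨p, hx, hy⟩ :=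
      continuous_subtype_val.continuousAt
    filter_upwards [hc (h x p hx), hc (h y p hy), hc ((nhd p).isOpen.mem_nhds (mem_nhd p))]
      with q h1 h2 h3
    have h1 : fr x q.2.1 = _ := h1 q.2.1 h3
    have h2 : fr y q.2.2 = _ := h2 q.2.2 h3
    ext
    simp [h1, h2]⟩
  cocycle x y z p hx hy hz := by ext; simp

theorem ofFrame_frame (nhd : X → Opens X) (mem_nhd : ∀ x, x ∈ nhd x) (obj : X → C)
    (fr : ∀ (x : X) {p : X} (_ : p ∈ nhd x), obj x ≅ obj p)
    (h : ∀ x p (hp : p ∈ nhd x), ∀ᶠ q in 𝓝 p, ∀ (h : q ∈ nhd x) (h' : q ∈ nhd p),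
      fr x h = fr x hp ≪≫ fr p h') (x : X) {p : X} (hp : p ∈ nhd x) :
    (ofFrame nhd mem_nhd obj fr h).frame x hp = fr x hp := by
  have hs : fr p (mem_nhd p) = Iso.refl _ := by
    have h1 := congrArg (fun e => (fr p (mem_nhd p)).symm ≪≫ e)
      ((h p p (mem_nhd p)).self_of_nhds (mem_nhd p) (mem_nhd p))
    simpa using h1.symm
  change fr x hp ≪≫ (fr p (mem_nhd p)).symm = _
  rw [hs]
  ext
  simp

/-- Local systems glue: every descent datum is effective. -/
theorem exists_of_descent {ι : Type*} (V : ι → Opens X) (hV : ∀ x, ∃ i, x ∈ V i)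
    (L : ∀ i, LocalSystem (V i) C)
    (θ : ∀ i j, (pullback (inclusion (inf_le_left : V i ⊓ V j ≤ V i))).obj (L i) ≅
      (pullback (inclusion (inf_le_right : V i ⊓ V j ≤ V j))).obj (L j))
    (hθ : ∀ i j k x (hi : x ∈ V i) (hj : x ∈ V j) (hk : x ∈ V k),
      (show (L i).obj ⟨x, hi⟩ ⟶ (L j).obj ⟨x, hj⟩ from (θ i j).hom.app ⟨x, hi, hj⟩) ≫
        (show (L j).obj ⟨x, hj⟩ ⟶ (L k).obj ⟨x, hk⟩ from (θ j k).hom.app ⟨x, hj, hk⟩) =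
          (θ i k).hom.app ⟨x, hi, hk⟩) :
    ∃ (M : LocalSystem X C) (ψ : ∀ i, (restrict (V i)).obj M ≅ L i),
      ∀ i j x (hi : x ∈ V i) (hj : x ∈ V j),
        (show M.obj x ⟶ (L i).obj ⟨x, hi⟩ from (ψ i).hom.app ⟨x, hi⟩) ≫
          (show (L i).obj ⟨x, hi⟩ ⟶ (L j).obj ⟨x, hj⟩ from (θ i j).hom.app ⟨x, hi, hj⟩) =
            (ψ j).hom.app ⟨x, hj⟩ := by
  let t : ∀ i j x (hi : x ∈ V i) (hj : x ∈ V j), (L i).obj ⟨x, hi⟩ ≅ (L j).obj ⟨x, hj⟩ :=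
    fun i j x hi hj => (stalk C (⟨x, hi, hj⟩ : ↥(V i ⊓ V j))).mapIso (θ i j)
  have ht : ∀ i j k x (hi : x ∈ V i) (hj : x ∈ V j) (hk : x ∈ V k),
      (t i j x hi hj).hom ≫ (t j k x hj hk).hom = (t i k x hi hk).hom := hθ
  have sub2 : ∀ i j x (hi : x ∈ V i) (hj : x ∈ V j), ∀ᶠ p in 𝓝 x, ∀ (hpi : p ∈ V i) (hpj : p ∈ V j)
      (h : ⟨p, hpi⟩ ∈ (L i).nhd ⟨x, hi⟩) (h' : ⟨p, hpj⟩ ∈ (L j).nhd ⟨x, hj⟩),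
      ((L i).frame _ h).hom ≫ (t i j p hpi hpj).hom =
        (t i j x hi hj).hom ≫ ((L j).frame _ h').hom := by
    intro i j x hi hj
    filter_upwards [eventually_of_subtype (V i ⊓ V j) _
      ((θ i j).hom.eventually_app ⟨x, hi, hj⟩)] with p h hpi hpj h1 h2
    exact h ⟨hpi, hpj⟩ h1 h2
  choose i hi using hV
  have frm : ∀ x p (hp : p ∈ V (i x)) (h : ⟨p, hp⟩ ∈ (L (i x)).nhd ⟨x, hi x⟩),
    ∀ᶠ q in 𝓝 p, ∀ (hx : q ∈ V (i x)) (hx' : ⟨q, hx⟩ ∈ (L (i x)).nhd ⟨x, hi x⟩)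
      (hq' : ⟨q, hx⟩ ∈ (L (i x)).nhd ⟨p, hp⟩),
      (L (i x)).frame _ hx' = (L (i x)).frame _ h ≪≫ (L (i x)).frame _ hq' := by
    intro x p hp h
    filter_upwards [eventually_of_subtype _ _ ((L (i x)).eventually_frame ⟨x, hi x⟩ ⟨p, hp⟩ h)] with q hq a b c
    exact hq a b c
  let nhd : X → Opens X := fun x =>
    ⟨Subtype.val '' ((L (i x)).nhd ⟨x, hi x⟩ : Set (V (i x))),
      (V (i x)).isOpen.isOpenMap_subtype_val _ ((L (i x)).nhd ⟨x, hi x⟩).isOpen⟩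
  have m1 : ∀ {x p}, p ∈ nhd x → p ∈ V (i x) := by
    rintro x p ⟨p, _, rfl⟩; exact p.2
  have m2 : ∀ {x p} (h : p ∈ nhd x), ⟨p, m1 h⟩ ∈ (L (i x)).nhd ⟨x, hi x⟩ := by
    rintro x p ⟨p, h, rfl⟩; exact h
  have mem : ∀ x, x ∈ nhd x := fun x => ⟨⟨x, hi x⟩, (L (i x)).mem_nhd _, rfl⟩
  have nh : ∀ j x (hj : x ∈ V j), ∀ᶠ p in 𝓝 x, ∃ h : p ∈ V j, ⟨p, h⟩ ∈ (L j).nhd ⟨x, hj⟩ := by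
    intro j x hj
    filter_upwards [eventually_of_subtype (V j) ⟨x, hj⟩
        (((L j).nhd ⟨x, hj⟩).isOpen.mem_nhds ((L j).mem_nhd _)),
      (V j).isOpen.mem_nhds hj] with p h h'
    exact ⟨h', h h'⟩
  let M := ofFrame nhd mem (fun x => (L (i x)).obj ⟨x, hi x⟩)
    (fun x p h => (L (i x)).frame _ (m2 h) ≪≫ t (i x) (i p) p (m1 h) (hi p)) (by
      intro x p hp
      filter_upwards [frm x p (m1 hp) (m2 hp), sub2 (i x) (i p) p (m1 hp) (hi p), nh (i x) p (m1 hp)]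
        with q h1 h2 ⟨h3, h4⟩ h h'
      ext
      have h2 := h2 h3 (m1 h') h4 (m2 h')
      simp [h1 h3 (m2 h) h4, ← ht (i x) (i p) (i q) q h3 (m1 h') (hi q), reassoc_of% h2])
  refine ⟨M, fun j => isoMk (fun p => t (i p.1) j p.1 (hi p.1) p.2) ?_, ?_⟩
  · rintro ⟨p, hp⟩
    have hc : ContinuousAt (Subtype.val : V j → X) ⟨p, hp⟩ := continuous_subtype_val.continuousAt
    filter_upwards [hc (sub2 (i p) j p (hi p) hp)] with ⟨q, hq⟩ h1 h h'
    have h : q ∈ nhd p := h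
    have h1 := h1 (m1 h) hq (m2 h) h'
    refine Eq.trans ?_ h1
    rw [pullback_frame]
    refine (congrArg (fun e => Iso.hom e ≫ _) (ofFrame_frame ..)).trans ?_
    exact (Category.assoc _ _ _).trans (congrArg (_ ≫ ·) (ht _ _ _ _ _ _ _))
  · intro j k x hj hk
    exact ht _ _ _ _ _ _ _

end ConstantStack

section Etale

variable {X : Type u} [TopologicalSpace X] {C : Type w} [Category.{v} C]

/-- The étalé space of the sheaf of morphisms from the constant system with stalk `A` to `L`. It is
only used to lift paths. -/
@[ext]
structure HomGerm (A : C) (L : LocalSystem X C) where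
  pt : X
  hom : A ⟶ L.obj pt

namespace HomGerm

variable {A : C} {L : LocalSystem X C}

instance : TopologicalSpace (HomGerm A L) where
  IsOpen O := ∀ e ∈ O, ∀ᶠ q in 𝓝 e.pt, ∀ h : q ∈ L.nhd e.pt,
    (⟨q, e.hom ≫ (L.frame e.pt h).hom⟩ : HomGerm A L) ∈ O
  isOpen_univ := by simp
  isOpen_inter s t hs ht e he := by
    filter_upwards [hs e he.1, ht e he.2] with q h1 h2 h
    exact ⟨h1 h, h2 h⟩
  isOpen_sUnion S hS e := by
    rintro ⟨s, hs, he⟩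
    filter_upwards [hS s hs e he] with q h1 h
    exact ⟨s, hs, h1 h⟩

theorem isOpen_iff {O : Set (HomGerm A L)} : IsOpen O ↔ ∀ e ∈ O, ∀ᶠ q in 𝓝 e.pt,
    ∀ h : q ∈ L.nhd e.pt, (⟨q, e.hom ≫ (L.frame e.pt h).hom⟩ : HomGerm A L) ∈ O := Iff.rfl

theorem continuous_pt : Continuous (pt : HomGerm A L → X) := by
  refine continuous_def.2 fun V hV => isOpen_iff.2 fun e he => ?_
  filter_upwards [hV.mem_nhds he] with q hq h
  exact hq

theorem isCoveringMap : IsCoveringMap (pt : HomGerm A L → X) := by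
  intro x
  let _ : TopologicalSpace (A ⟶ L.obj x) := ⊥
  have : DiscreteTopology (A ⟶ L.obj x) := ⟨rfl⟩
  refine IsEvenlyCovered.to_isEvenlyCovered_preimage (I := (A ⟶ L.obj x))
    ⟨inferInstance, L.nhd x, L.mem_nhd x, (L.nhd x).isOpen,
      (L.nhd x).isOpen.preimage continuous_pt, ?_, ?_⟩
  · refine
      { toFun := fun e => (⟨e.1.pt, e.2⟩, e.1.hom ≫ (L.frame x e.2).inv)
        invFun := fun a => ⟨⟨a.1.1, a.2 ≫ (L.frame x a.1.2).hom⟩, a.1.2⟩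
        left_inv := fun e => by simp
        right_inv := fun a => by simp
        continuous_toFun := ?_
        continuous_invFun := ?_ }
    · refine Continuous.prodMk ?_ ?_
      · exact (continuous_pt.comp continuous_subtype_val).subtype_mk _
      · refine continuous_discrete_rng.2 fun f => ?_
        have : IsOpen {e : HomGerm A L | ∃ h : e.pt ∈ L.nhd x, e.hom ≫ (L.frame x h).inv = f} := by
          refine isOpen_iff.2 ?_
          rintro ⟨p, g⟩ ⟨h : p ∈ L.nhd x, hf : g ≫ _ = f⟩
          filter_upwards [L.eventually_frame x p h, (L.nhd x).isOpen.mem_nhds h] with q h1 h2 h3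
          refine ⟨h2, ?_⟩
          simp [h1 h2 h3, ← hf]
        convert this.preimage continuous_subtype_val using 1
        ext ⟨e, he⟩
        constructor
        · intro h; exact ⟨he, h⟩
        · rintro ⟨_, h⟩; exact h
    · refine Continuous.subtype_mk ?_ _
      refine continuous_prod_of_discrete_right.2 fun f => ?_
      refine continuous_def.2 fun O hO => isOpen_iff_mem_nhds.2 ?_
      rintro ⟨p, hp⟩ hpO
      have h1 := hO _ hpO
      have hc : ContinuousAt (Subtype.val : ↥(L.nhd x) → X) ⟨p, hp⟩ :=
        continuous_subtype_val.continuousAt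
      filter_upwards [hc h1, hc (L.eventually_frame x p hp),
        hc ((L.nhd p).isOpen.mem_nhds (L.mem_nhd p))] with q h1 h2 h3
      have h2 : L.frame x _ = _ := h2 q.2 h3
      have h1 := h1 h3
      simp only [Category.assoc] at h1
      simp only [Set.mem_preimage]
      rw [h2]
      exact h1
  · intro e
    rfl

theorem isOpen_basic (e : HomGerm A L) :
    IsOpen {e' : HomGerm A L | ∃ h : e'.pt ∈ L.nhd e.pt,
      e'.hom = e.hom ≫ (L.frame e.pt h).hom} := by
  refine isOpen_iff.2 ?_
  rintro ⟨p, g⟩ ⟨h, hg⟩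
  dsimp only at h hg
  filter_upwards [L.eventually_frame e.pt p h, (L.nhd e.pt).isOpen.mem_nhds h] with q h1 h2 h3
  exact ⟨h2, by simp [h1 h2 h3, hg]⟩

end HomGerm

end Etale

section Interval

variable {C : Type w} [Category.{v} C]

theorem isIso_of_isIso_app {X : Type u} [TopologicalSpace X] [PreconnectedSpace X]
    {L L' : LocalSystem X C} (φ : L ⟶ L') (x₀ : X) (h₀ : IsIso (φ.app x₀)) : IsIso φ := by
  have hcl : IsClopen {x | IsIso (φ.app x)} := by
    have key : ∀ x, ∀ᶠ p in 𝓝 x, IsIso (φ.app p) ↔ IsIso (φ.app x) := by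
      intro x
      filter_upwards [φ.eventually_app x, (L.nhd x).isOpen.mem_nhds (L.mem_nhd x),
        (L'.nhd x).isOpen.mem_nhds (L'.mem_nhd x)] with p h1 h2 h3
      have h := h1 h2 h3
      constructor
      · intro hp
        have : φ.app x = (L.frame x h2).hom ≫ φ.app p ≫ (L'.frame x h3).inv := by
          rw [reassoc_of% h]; simp
        rw [this]; infer_instance
      · intro hp
        have : φ.app p = (L.frame x h2).inv ≫ φ.app x ≫ (L'.frame x h3).hom := by
          rw [← h]; simp
        rw [this]; infer_instance
    constructor
    · rw [← isOpen_compl_iff, isOpen_iff_mem_nhds]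
      intro x hx
      filter_upwards [key x] with p hp hp'
      exact hx (hp.1 hp')
    · rw [isOpen_iff_mem_nhds]
      intro x hx
      filter_upwards [key x] with p hp
      exact hp.2 hx
  have huniv := hcl.eq_univ ⟨x₀, h₀⟩
  exact isIso_of_isIso_app' φ fun x => (huniv ▸ Set.mem_univ x : x ∈ {x | IsIso (φ.app x)})

/-- A family of morphisms `A ⟶ L_x` which is locally constant, i.e. given near each point by a
constant family in the frame at that point. -/
def IsParallel {X : Type u} [TopologicalSpace X] (L : LocalSystem X C) {A : C}
    (ψ : ∀ x, A ⟶ L.obj x) : Prop :=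
  ∀ x, ∀ᶠ p in 𝓝 x, ∀ h : p ∈ L.nhd x, ψ p = ψ x ≫ (L.frame x h).hom

/-- Parallel families `A ⟶ L_x` are the same as morphisms from the constant system. -/
@[simps]
def homOfParallel {X : Type u} [TopologicalSpace X] (L : LocalSystem X C) {A : C}
    (ψ : ∀ x, A ⟶ L.obj x) (h : L.IsParallel ψ) : (unit X C).obj A ⟶ L where
  app := ψ
  eventually_app x := by
    filter_upwards [h x] with p hp _ h'
    exact (Category.id_comp (ψ p)).trans (hp h')

theorem isParallel_app {X : Type u} [TopologicalSpace X] {L : LocalSystem X C} {A : C}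
    (φ : (unit X C).obj A ⟶ L) : L.IsParallel fun x => (φ.app x : A ⟶ L.obj x) := fun x => by
  filter_upwards [φ.eventually_app x] with p hp h
  exact (Category.id_comp _).symm.trans (hp trivial h)

theorem app_eq_of_hom_unit {X : Type u} [TopologicalSpace X] [PreconnectedSpace X] {M N : C}
    (φ : (unit X C).obj M ⟶ (unit X C).obj N) (x y : X) :
    (show M ⟶ N from φ.app x) = φ.app y := by
  have : IsLocallyConstant fun x => (show M ⟶ N from φ.app x) := by
    rw [IsLocallyConstant.iff_eventually_eq]
    intro x
    filter_upwards [isParallel_app φ x] with p hp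
    exact (hp trivial).trans (Category.comp_id _)
  exact this.apply_eq_of_preconnectedSpace x y

/-- A local system on the unit interval is constant. -/
theorem exists_iso_unit (L : LocalSystem unitInterval C) :
    ∃ M : C, Nonempty ((unit unitInterval C).obj M ≅ L) := by
  let cov := HomGerm.isCoveringMap (A := L.obj 0) (L := L)
  obtain ⟨Γ, hΓ, hΓ0⟩ := cov.exists_path_lifts (ContinuousMap.id unitInterval)
    (⟨0, 𝟙 _⟩ : HomGerm (L.obj 0) L) rfl
  have hpt : ∀ t, (Γ t).pt = t := fun t => congrFun hΓ t
  let ψ : ∀ t, L.obj 0 ⟶ L.obj t := fun t => (Γ t).hom ≫ eqToHom (by rw [hpt])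
  have hψ : ∀ t, Γ t = ⟨t, ψ t⟩ := fun t => by
    have : ∀ (e : HomGerm (L.obj 0) L) (h : e.pt = t),
        e = ⟨t, e.hom ≫ eqToHom (by rw [h])⟩ := by
      rintro e rfl; simp
    exact this _ (hpt t)
  have hpar : L.IsParallel ψ := fun t => by
    have h1 := Γ.continuous.continuousAt.preimage_mem_nhds
      ((HomGerm.isOpen_basic (⟨t, ψ t⟩ : HomGerm (L.obj 0) L)).mem_nhds
        (x := Γ t) (by rw [hψ]; exact ⟨L.mem_nhd t, by simp [frame_self]⟩))
    filter_upwards [h1] with s hs h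
    simp only [Set.mem_preimage, hψ s] at hs
    exact hs.2
  let φ := L.homOfParallel ψ hpar
  have h0 : ψ 0 = 𝟙 _ := by
    have := (hψ 0).symm.trans hΓ0
    simpa using this
  have := isIso_of_isIso_app φ 0 (by
    change IsIso (ψ 0)
    rw [h0]; infer_instance)
  exact ⟨_, ⟨asIso φ⟩⟩

/-- On the unit interval `η_I` is an equivalence. -/
instance : (unit unitInterval C).IsEquivalence where
  faithful := ⟨fun h => congrArg (fun φ => Hom.app φ 0) h⟩
  full := ⟨fun φ => ⟨φ.app 0, by ext t; exact app_eq_of_hom_unit φ 0 t⟩⟩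
  essSurj := ⟨fun L => exists_iso_unit L⟩

variable (C) in
/-- The canonical isomorphism from a quasi-inverse of `η_I` to the stalk functor `ω_t`. -/
noncomputable def sectionsIsoStalk (t : unitInterval) :
    (unit unitInterval C).inv ≅ stalk C t :=
  (Functor.isoWhiskerRight (unit unitInterval C).asEquivalence.counitIso (stalk C t) :)

variable (C) in
/-- The composite `ω_0 ≅ η_I⁻¹ ≅ ω_1`. -/
noncomputable def stalkZeroIsoStalkOne : stalk C (0 : unitInterval) ≅ stalk C (1 : unitInterval) :=
  (sectionsIsoStalk C 0).symm ≪≫ sectionsIsoStalk C 1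

theorem app_stalkZeroIsoStalkOne (L : LocalSystem unitInterval C) {A : C}
    (ψ : (unit unitInterval C).obj A ⟶ L) :
    ψ.app 0 ≫ (stalkZeroIsoStalkOne C).hom.app L = ψ.app 1 := by
  let e := (unit unitInterval C).asEquivalence.counitIso.app L
  let B : C := (unit unitInterval C).inv.obj L
  let e0 : L.obj 0 ⟶ B := Hom.app e.inv 0
  let e1 : L.obj 1 ⟶ B := Hom.app e.inv 1
  let e1' : B ⟶ L.obj 1 := Hom.app e.hom 1
  let p0 : A ⟶ L.obj 0 := ψ.app 0
  let p1 : A ⟶ L.obj 1 := ψ.app 1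
  have h : p0 ≫ e0 = p1 ≫ e1 := app_eq_of_hom_unit (N := B) (ψ ≫ e.inv) 0 1
  have h1 : e1 ≫ e1' = 𝟙 _ := congrArg (fun φ => Hom.app φ 1) e.inv_hom_id
  change p0 ≫ e0 ≫ e1' = p1
  rw [reassoc_of% h, h1, Category.comp_id]

end Interval

section Monodromy

variable {X : Type u} [TopologicalSpace X] {C : Type w} [Category.{v} C]

/-- The transport of a local system along a path `γ` from `x` to `y`, that is the composite
`ω_x L ≅ ω_0 (γ⁻¹ L) ≅ η_I⁻¹ (γ⁻¹ L) ≅ ω_1 (γ⁻¹ L) ≅ ω_y L`. -/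
noncomputable def transport (L : LocalSystem X C) {x y : X} (γ : Path x y) : L.obj x ≅ L.obj y :=
  eqToIso (congrArg L.obj γ.source.symm) ≪≫
    (stalkZeroIsoStalkOne C).app ((pullback γ.toContinuousMap).obj L) ≪≫
      eqToIso (congrArg L.obj γ.target)

theorem transport_eq (L : LocalSystem X C) {x y : X} (γ : Path x y) {A : C}
    (ψ : ∀ t : unitInterval, A ⟶ L.obj (γ t))
    (h : ((pullback γ.toContinuousMap).obj L).IsParallel ψ) :
    (ψ 0 ≫ eqToHom (congrArg L.obj γ.source)) ≫ (L.transport γ).hom =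
      ψ 1 ≫ eqToHom (congrArg L.obj γ.target) := by
  have h1 : ψ 0 ≫ (stalkZeroIsoStalkOne C).hom.app ((pullback γ.toContinuousMap).obj L) = ψ 1 :=
    app_stalkZeroIsoStalkOne _ (homOfParallel ((pullback γ.toContinuousMap).obj L) ψ h)
  rw [← h1]
  simp only [transport, Iso.trans_hom, eqToIso.hom, Category.assoc]
  erw [eqToHom_trans_assoc]
  rw [eqToHom_refl, Category.id_comp]
  exact (Category.assoc (ψ 0)
    ((stalkZeroIsoStalkOne C).hom.app ((pullback γ.toContinuousMap).obj L)) _).symm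

theorem exists_parallel (L : LocalSystem unitInterval C) {A : C} (f : A ⟶ L.obj 0) :
    ∃ ψ : ∀ t, A ⟶ L.obj t, L.IsParallel ψ ∧ ψ 0 = f := by
  obtain ⟨M, ⟨e⟩⟩ := exists_iso_unit L
  let g : L.obj 0 ⟶ M := Hom.app e.inv 0
  refine ⟨_, isParallel_app ((unit unitInterval C).map (f ≫ g) ≫ e.hom), ?_⟩
  let g' : M ⟶ L.obj 0 := Hom.app e.hom 0
  have h1 : g ≫ g' = 𝟙 _ := congrArg (fun φ => Hom.app φ 0) e.inv_hom_id
  change (f ≫ g) ≫ g' = f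
  rw [Category.assoc, h1, Category.comp_id]

theorem exists_parallel_path (L : LocalSystem X C) {x y : X} (γ : Path x y) {A : C}
    (f : A ⟶ L.obj x) : ∃ ψ : ∀ t : unitInterval, A ⟶ L.obj (γ t),
      ((pullback γ.toContinuousMap).obj L).IsParallel ψ ∧
      ψ 0 ≫ eqToHom (congrArg L.obj γ.source) = f ∧
      ψ 1 ≫ eqToHom (congrArg L.obj γ.target) = f ≫ (L.transport γ).hom := by
  obtain ⟨ψ, hψ, h0⟩ := exists_parallel ((pullback γ.toContinuousMap).obj L)
    (show A ⟶ L.obj (γ 0) from f ≫ eqToHom (congrArg L.obj γ.source.symm))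
  have h0' : (show A ⟶ L.obj (γ 0) from ψ 0) ≫ eqToHom (congrArg L.obj γ.source) = f := by
    rw [h0]
    exact (Category.assoc _ _ _).trans (by rw [eqToHom_trans, eqToHom_refl, Category.comp_id])
  refine ⟨ψ, hψ, h0', ?_⟩
  rw [← L.transport_eq γ ψ hψ]
  exact congrArg (· ≫ (L.transport γ).hom) h0'

theorem continuous_homGerm {Y : Type u'} [TopologicalSpace Y] (L : LocalSystem X C)
    (f : C(Y, X)) {A : C} (ψ : ∀ t, A ⟶ L.obj (f t)) (h : ((pullback f).obj L).IsParallel ψ) :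
    Continuous fun t => (⟨f t, ψ t⟩ : HomGerm A L) := by
  refine continuous_def.2 fun O hO => isOpen_iff_mem_nhds.2 fun t ht => ?_
  filter_upwards [f.continuous.continuousAt (hO _ ht), h t,
    f.continuous.continuousAt ((L.nhd (f t)).isOpen.mem_nhds (L.mem_nhd _))] with s h1 h2 h3
  have h2 : ψ s = ψ t ≫ (L.frame (f t) (p := f s) h3).hom := h2 h3
  change (⟨f s, ψ s⟩ : HomGerm A L) ∈ O
  rw [h2]
  exact h1 h3

theorem homGerm_mk_eq (L : LocalSystem X C) {A : C} {x y : X} (h : x = y) (f : A ⟶ L.obj x) :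
    (⟨x, f⟩ : HomGerm A L) = ⟨y, f ≫ eqToHom (congrArg L.obj h)⟩ := by
  subst h; simp

theorem monodromy_homGerm (L : LocalSystem X C) {x y : X} (γ : Path x y) {A : C} (f : A ⟶ L.obj x) :
    ((HomGerm.isCoveringMap (A := A) (L := L)).monodromy (.mk γ) ⟨⟨x, f⟩, rfl⟩).1 =
      ⟨y, f ≫ (L.transport γ).hom⟩ := by
  obtain ⟨ψ, hψ, h0, h1⟩ := L.exists_parallel_path γ f
  have hc := continuous_homGerm L γ.toContinuousMap ψ hψ
  have key := ((HomGerm.isCoveringMap (A := A) (L := L)).eq_liftPath_iff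
    (γ := γ.toContinuousMap) (e := ⟨x, f⟩) γ.source).2 ⟨hc, rfl,
      (homGerm_mk_eq L γ.source (ψ 0)).trans (by rw [h0])⟩
  exact (congrFun key 1).symm.trans ((homGerm_mk_eq L γ.target (ψ 1)).trans (by rw [h1]))

theorem transport_congr (L : LocalSystem X C) {x y : X} {γ γ' : Path x y} (h : γ.Homotopic γ') :
    L.transport γ = L.transport γ' := by
  have h1 := L.monodromy_homGerm γ (𝟙 _)
  rw [show (Path.Homotopic.Quotient.mk γ) = .mk γ' from Quotient.sound h,
    monodromy_homGerm] at h1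
  ext
  simpa using h1.symm

theorem transport_refl (L : LocalSystem X C) (x : X) :
    L.transport (Path.refl x) = Iso.refl _ := by
  have h1 := L.monodromy_homGerm (Path.refl x) (𝟙 _)
  have h2 := (HomGerm.isCoveringMap (A := L.obj x) (L := L)).monodromy_refl (x := x)
  rw [show (Path.Homotopic.Quotient.mk (Path.refl x)) = .refl x from rfl, h2] at h1
  ext
  simpa using h1.symm

theorem transport_trans (L : LocalSystem X C) {x y z : X} (γ : Path x y) (γ' : Path y z) :
    L.transport (γ.trans γ') = L.transport γ ≪≫ L.transport γ' := by
  have h1 := L.monodromy_homGerm (γ.trans γ') (𝟙 _)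
  rw [show (Path.Homotopic.Quotient.mk (γ.trans γ')) = .trans (.mk γ) (.mk γ') from rfl,
    IsCoveringMap.monodromy_trans_apply] at h1
  have h2 : (HomGerm.isCoveringMap (A := L.obj x) (L := L)).monodromy (.mk γ) ⟨⟨x, 𝟙 _⟩, rfl⟩ =
    ⟨⟨y, 𝟙 _ ≫ (L.transport γ).hom⟩, rfl⟩ := Subtype.ext (L.monodromy_homGerm γ (𝟙 _))
  rw [h2, monodromy_homGerm] at h1
  ext
  simpa using h1.symm

theorem app_eqToHom {L L' : LocalSystem X C} (φ : L ⟶ L') {x y : X} (h : x = y) :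
    φ.app x ≫ eqToHom (congrArg L'.obj h) = eqToHom (congrArg L.obj h) ≫ φ.app y := by
  subst h; simp

theorem transport_naturality {L L' : LocalSystem X C} (φ : L ⟶ L') {x y : X} (γ : Path x y) :
    (L.transport γ).hom ≫ φ.app y = φ.app x ≫ (L'.transport γ).hom := by
  obtain ⟨ψ, hψ, h0, h1⟩ := L.exists_parallel_path γ (𝟙 _)
  have h2 := L'.transport_eq γ (fun t => ψ t ≫ φ.app (γ t))
    (isParallel_app (homOfParallel (A := L.obj x) ((pullback γ.toContinuousMap).obj L) ψ hψ ≫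
      (pullback γ.toContinuousMap).map φ))
  simp only [Category.assoc] at h2
  rw [reassoc_of% (app_eqToHom φ γ.source), app_eqToHom φ γ.target, reassoc_of% h0,
    reassoc_of% h1] at h2
  simpa using h2.symm

theorem map_transport {D : Type w'} [Category.{v'} D] (F : C ⥤ D) (L : LocalSystem X C) {x y : X}
    (γ : Path x y) :
    F.map (L.transport γ).hom = (((mapCoeff X F).obj L).transport γ).hom := by
  obtain ⟨ψ, hψ, h0, h1⟩ := L.exists_parallel_path γ (𝟙 _)
  have h2 := ((mapCoeff X F).obj L).transport_eq γ (fun t => F.map (ψ t)) (fun t => by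
    filter_upwards [hψ t] with s hs h
    exact (congrArg F.map (hs h)).trans (F.map_comp _ _))
  have h3 := congrArg F.map h0
  have h4 := congrArg F.map h1
  rw [F.map_comp, eqToHom_map] at h3 h4
  rw [Category.id_comp] at h4
  rw [← h4]
  refine h2.symm.trans ?_
  refine (congrArg (· ≫ (((mapCoeff X F).obj L).transport γ).hom) h3).trans ?_
  rw [F.map_id]
  exact Category.id_comp _

variable (X C) in
/-- The monodromy functor `μ_{X,C}` from local systems to functors on the Poincaré groupoid. It
sends `L` to the functor `x ↦ ω_x L`, which maps the class of a path to the transport of `L`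
along it. -/
@[simps]
noncomputable def monodromy : LocalSystem X C ⥤ (FundamentalGroupoid X ⥤ C) where
  obj L :=
    { obj := fun x => L.obj x.as
      map := fun {x y} γ => Quotient.lift (s := Path.Homotopic.setoid x.as y.as)
        (fun γ : Path x.as y.as => (L.transport γ).hom)
        (fun _ _ h => congrArg Iso.hom (L.transport_congr h)) γ
      map_id := fun x => congrArg Iso.hom (L.transport_refl x.as)
      map_comp := fun f g => by
        obtain ⟨f⟩ := f
        obtain ⟨g⟩ := g
        exact congrArg Iso.hom (L.transport_trans f g) }
  map φ :=
    { app := fun x => φ.app x.as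
      naturality := fun x y γ => by
        obtain ⟨γ⟩ := γ
        exact transport_naturality φ γ }

variable (X) in
/-- The monodromy commutes with change of coefficients. -/
noncomputable def monodromyMapCoeff {D : Type w'} [Category.{v'} D] (F : C ⥤ D) :
    mapCoeff X F ⋙ monodromy X D ≅
      monodromy X C ⋙ (Functor.whiskeringRight (FundamentalGroupoid X) C D).obj F :=
  NatIso.ofComponents
    (fun L => NatIso.ofComponents
      (F := (monodromy X D).obj ((mapCoeff X F).obj L))
      (G := (monodromy X C).obj L ⋙ F)
      (fun x => Iso.refl (F.obj (L.obj x.as)))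
      (fun {x y} γ => by
        obtain ⟨γ⟩ := γ
        refine (Category.comp_id _).trans (Eq.trans ?_ (Category.id_comp _).symm)
        exact (map_transport F L γ).symm))
    (fun {L L'} φ => NatTrans.ext (funext fun x =>
      (Category.comp_id (F.map (φ.app x.as))).trans (Category.id_comp _).symm))

end Monodromy

end LocalSystem

section TwoFunctors

open Bicategory LocalSystem

variable (X : Type u) [TopologicalSpace X]

/-- The 2-functor `C ↦ Γ(X, C_X)` of global sections of constant stacks on `X`. -/
noncomputable def globalSections : Cat.{v, w} ⥤ᵖ Cat.{max u v, max u v w} where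
  obj C := Cat.of (LocalSystem X C)
  map F := (mapCoeff X F.toFunctor).toCatHom
  map₂ α := (mapCoeffNat X α.toNatTrans).toCatHom₂
  map₂_id F := Cat.Hom₂.ext (NatTrans.ext (funext fun L => hom_ext fun x => rfl))
  map₂_comp α β := Cat.Hom₂.ext (NatTrans.ext (funext fun L => hom_ext fun x => rfl))
  mapId C := Cat.Hom.isoMk (mapCoeffId X C)
  mapComp F G := Cat.Hom.isoMk (mapCoeffComp X F.toFunctor G.toFunctor)
  map₂_whisker_left {A B C} F {G H} η := by
    refine Cat.Hom₂.ext (NatTrans.ext (funext fun L => hom_ext fun x => ?_))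
    let c : A := LocalSystem.obj L x
    change η.toNatTrans.app (F.toFunctor.obj c) =
      𝟙 (G.toFunctor.obj (F.toFunctor.obj c)) ≫ η.toNatTrans.app (F.toFunctor.obj c) ≫
        𝟙 (H.toFunctor.obj (F.toFunctor.obj c))
    simp
  map₂_whisker_right {A B C F G} η H := by
    refine Cat.Hom₂.ext (NatTrans.ext (funext fun L => hom_ext fun x => ?_))
    let c : A := LocalSystem.obj L x
    change H.toFunctor.map (η.toNatTrans.app c) =
      𝟙 (H.toFunctor.obj (F.toFunctor.obj c)) ≫ H.toFunctor.map (η.toNatTrans.app c) ≫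
        𝟙 (H.toFunctor.obj (G.toFunctor.obj c))
    simp
  map₂_associator F G H := by
    refine Cat.Hom₂.ext (NatTrans.ext (funext fun L => hom_ext fun x => ?_))
    let d := H.toFunctor.obj (G.toFunctor.obj (F.toFunctor.obj (LocalSystem.obj L x)))
    change 𝟙 d = 𝟙 d ≫ H.toFunctor.map (𝟙 (G.toFunctor.obj (F.toFunctor.obj (LocalSystem.obj L x)))) ≫
      𝟙 d ≫ 𝟙 d ≫ 𝟙 d
    simp [d]
  map₂_left_unitor F := by
    refine Cat.Hom₂.ext (NatTrans.ext (funext fun L => hom_ext fun x => ?_))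
    let c := LocalSystem.obj L x
    change 𝟙 (F.toFunctor.obj c) = 𝟙 (F.toFunctor.obj c) ≫ F.toFunctor.map (𝟙 c) ≫
      𝟙 (F.toFunctor.obj c)
    simp
  map₂_right_unitor F := by
    refine Cat.Hom₂.ext (NatTrans.ext (funext fun L => hom_ext fun x => ?_))
    let d := F.toFunctor.obj (LocalSystem.obj L x)
    change 𝟙 d = 𝟙 d ≫ 𝟙 d ≫ 𝟙 d
    simp

/-- The 2-functor `C ↦ Hom(Π₁(X), C)`. -/
noncomputable def representations : Cat.{v, w} ⥤ᵖ Cat.{max u v, max u v w} where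
  obj C := Cat.of (FundamentalGroupoid X ⥤ C)
  map F := ((Functor.whiskeringRight (FundamentalGroupoid X) _ _).obj F.toFunctor).toCatHom
  map₂ α := ((Functor.whiskeringRight (FundamentalGroupoid X) _ _).map α.toNatTrans).toCatHom₂
  mapId C := Cat.Hom.isoMk (Iso.refl _)
  mapComp F G := Cat.Hom.isoMk (Iso.refl _)
  map₂_whisker_left {A B C} F {G H} η := by
    refine Cat.Hom₂.ext (NatTrans.ext (funext fun L => NatTrans.ext (funext fun x => ?_)))
    let c : A := Functor.obj L x
    change η.toNatTrans.app (F.toFunctor.obj c) =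
      𝟙 (G.toFunctor.obj (F.toFunctor.obj c)) ≫ η.toNatTrans.app (F.toFunctor.obj c) ≫
        𝟙 (H.toFunctor.obj (F.toFunctor.obj c))
    simp
  map₂_whisker_right {A B C F G} η H := by
    refine Cat.Hom₂.ext (NatTrans.ext (funext fun L => NatTrans.ext (funext fun x => ?_)))
    let c : A := Functor.obj L x
    change H.toFunctor.map (η.toNatTrans.app c) =
      𝟙 (H.toFunctor.obj (F.toFunctor.obj c)) ≫ H.toFunctor.map (η.toNatTrans.app c) ≫
        𝟙 (H.toFunctor.obj (G.toFunctor.obj c))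
    simp
  map₂_associator F G H := by
    refine Cat.Hom₂.ext (NatTrans.ext (funext fun L => NatTrans.ext (funext fun x => ?_)))
    let d := H.toFunctor.obj (G.toFunctor.obj (F.toFunctor.obj (Functor.obj L x)))
    change 𝟙 d = 𝟙 d ≫ H.toFunctor.map (𝟙 (G.toFunctor.obj (F.toFunctor.obj (Functor.obj L x)))) ≫
      𝟙 d ≫ 𝟙 d ≫ 𝟙 d
    simp [d]
  map₂_left_unitor F := by
    refine Cat.Hom₂.ext (NatTrans.ext (funext fun L => NatTrans.ext (funext fun x => ?_)))
    let c := Functor.obj L x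
    change 𝟙 (F.toFunctor.obj c) = 𝟙 (F.toFunctor.obj c) ≫ F.toFunctor.map (𝟙 c) ≫
      𝟙 (F.toFunctor.obj c)
    simp
  map₂_right_unitor F := by
    refine Cat.Hom₂.ext (NatTrans.ext (funext fun L => NatTrans.ext (funext fun x => ?_)))
    let d := F.toFunctor.obj (Functor.obj L x)
    change 𝟙 d = 𝟙 d ≫ 𝟙 d ≫ 𝟙 d
    simp

open scoped Pseudofunctor.StrongTrans

/-- The monodromy 2-transformation `μ_X`. -/
noncomputable def monodromyTransformation :
    Pseudofunctor.StrongTrans (globalSections.{v, w} X) (representations.{v, w} X) where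
  app C := (monodromy X C).toCatHom
  naturality {C D} F := Cat.Hom.isoMk (monodromyMapCoeff X F.toFunctor)
  naturality_naturality {a b f g} η := by
    refine Cat.Hom₂.ext (NatTrans.ext (funext fun L => NatTrans.ext (funext fun x => ?_)))
    let c : a := LocalSystem.obj L x.as
    change η.toNatTrans.app c ≫ 𝟙 (g.toFunctor.obj c) = 𝟙 (f.toFunctor.obj c) ≫ η.toNatTrans.app c
    simp
  naturality_id C := by
    refine Cat.Hom₂.ext (NatTrans.ext (funext fun L => NatTrans.ext (funext fun x => ?_)))
    let c : C := LocalSystem.obj L x.as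
    change 𝟙 c ≫ 𝟙 c = 𝟙 c ≫ 𝟙 c ≫ 𝟙 c
    simp
  naturality_comp F G := by
    refine Cat.Hom₂.ext (NatTrans.ext (funext fun L => NatTrans.ext (funext fun x => ?_)))
    let d := G.toFunctor.obj (F.toFunctor.obj (LocalSystem.obj L x.as))
    change 𝟙 d ≫ 𝟙 d = 𝟙 d ≫ 𝟙 d ≫ 𝟙 d ≫ 𝟙 d ≫
      G.toFunctor.map (𝟙 (F.toFunctor.obj (LocalSystem.obj L x.as))) ≫ 𝟙 d
    simp [d]

/-- A 2-transformation of 2-functors is an equivalence if it has an inverse up to invertible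
modifications. -/
def IsTwoEquivalence {F G : Cat.{v, w} ⥤ᵖ Cat.{v', w'}} (μ : Pseudofunctor.StrongTrans F G) :
    Prop :=
  let μ : F ⟶ G := μ
  ∃ ν : G ⟶ F, Nonempty (μ ≫ ν ≅ 𝟙 F) ∧ Nonempty (ν ≫ μ ≅ 𝟙 G)

/-- `X` is locally relatively 1-connected: each point has a fundamental system of path connected
neighbourhoods `U` such that each loop in `U` is null-homotopic in `X`. -/
def LocallyRelativelyOneConnected : Prop :=
  ∀ x : X, ∀ N ∈ 𝓝 x, ∃ U ∈ 𝓝 x, U ⊆ N ∧ IsPathConnected U ∧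
    ∀ (y : X) (γ : Path y y), (∀ t, γ t ∈ U) → γ.Homotopic (Path.refl y)

end TwoFunctors

/-! Parallel transport already turns a local system into a functor on the Poincaré groupoid; what
has to be built is the inverse. Fix for every `x` a path connected neighbourhood `U_x` whose loops
die in `X`. For `p` in `U_x`, all paths from `x` to `p` inside `U_x` then have one and the same
class in `X` (`pathClass`). A functor `F` gives a local system with stalk `F(x)` at `x`, whose frame
from `x` to `p` is the value of `F` on this class. The frames are locally constant because points
`q` near `p` can be joined to `p` inside `U_x ∩ U_p`, where path classes compose (`pathClass_comp`).

Both round trips are the identity on stalks, so only frames and transports need comparing. Starting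
from a local system `L`, a short path from `x` to `p` has transport equal to the frame of `L`
(`transport_eq_frame`), so the reconstructed frames agree with the old ones near `x`. Starting from
`F`, the transport along `γ` must be the value of `F` on the class of `γ` (`ofFunctor_transport`);
this is seen on the interval, where simple connectedness yields an explicit parallel family.

The neighbourhoods `U_x` do not depend on the coefficient category. The inverse is therefore
compatible with change of coefficients through identities on stalks, and the 2-categorical coherence
conditions reduce to equations between composites of identities. -/

/-- A choice, for each point `x`, of a path connected neighbourhood of `x` in which any two paths
with the same endpoints are homotopic in the whole space. -/
structure OneConnectedNhds (X : Type u) [TopologicalSpace X] where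
  nhd : X → Set X
  mem_nhds : ∀ x, nhd x ∈ 𝓝 x
  isPathConnected : ∀ x, IsPathConnected (nhd x)
  homotopic_refl : ∀ (x y : X) (γ : Path y y), (∀ t, γ t ∈ nhd x) → γ.Homotopic (Path.refl y)

theorem Path.mem_of_trans {X : Type u} [TopologicalSpace X] {U : Set X} {x y z : X}
    {γ : Path x y} {γ' : Path y z} (h : ∀ t, γ t ∈ U) (h' : ∀ t, γ' t ∈ U) (t : unitInterval) :
    γ.trans γ' t ∈ U := by
  rw [Path.trans_apply]
  split_ifs
  exacts [h _, h' _]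

/-! ### Path classes inside the chosen neighbourhoods. -/

namespace OneConnectedNhds

variable {X : Type u} [TopologicalSpace X]

theorem nonempty_of_locallyRelativelyOneConnected (hX : LocallyRelativelyOneConnected X) :
    Nonempty (OneConnectedNhds X) := by
  -- The chosen neighbourhoods need not be small, so the bound `N` is the whole space; arbitrarily
  -- small neighbourhoods enter only through `eventually_joinedIn`.
  choose U hU _ hc hl using fun x => hX x Set.univ Filter.univ_mem
  exact ⟨⟨U, hU, hc, hl⟩⟩

variable (U : OneConnectedNhds X)

/-- The homotopy class of the paths from `x` to `p` inside the chosen neighbourhood of `x`. -/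
noncomputable def pathClass (x : X) {p : X} (hp : p ∈ U.nhd x) :
    FundamentalGroupoid.mk x ⟶ FundamentalGroupoid.mk p :=
  Path.Homotopic.Quotient.mk
    ((U.isPathConnected x).joinedIn x (mem_of_mem_nhds (U.mem_nhds x)) p hp).somePath

/-- Following the selected path and returning along `γ` is a loop in the neighbourhood, hence
null-homotopic in `X`; composing with `γ` on the right gives the equality. This makes `pathClass`
independent of the path selected in its definition. -/
theorem pathClass_eq {x p : X} (hp : p ∈ U.nhd x) (γ : Path x p) (hγ : ∀ t, γ t ∈ U.nhd x) :
    U.pathClass x hp = Path.Homotopic.Quotient.mk γ := by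
  set δ := ((U.isPathConnected x).joinedIn x (mem_of_mem_nhds (U.mem_nhds x)) p hp).somePath with hδ
  have h : (Path.Homotopic.Quotient.mk δ).trans (.symm (.mk γ)) = .refl x :=
    Quotient.sound (U.homotopic_refl x x (δ.trans γ.symm)
      (Path.mem_of_trans (JoinedIn.somePath_mem _) fun t => hγ _))
  have h2 := congrArg (fun a => Path.Homotopic.Quotient.trans a (.mk γ)) h
  rw [Path.Homotopic.Quotient.trans_assoc, Path.Homotopic.Quotient.symm_trans,
    Path.Homotopic.Quotient.trans_refl, Path.Homotopic.Quotient.refl_trans] at h2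
  exact h2

/-- Inside the intersection of two chosen neighbourhoods, path classes compose. -/
theorem pathClass_comp {x p q : X} (hp : p ∈ U.nhd x) (hq : q ∈ U.nhd x) (hq' : q ∈ U.nhd p)
    (γ : Path p q) (hγ : ∀ t, γ t ∈ U.nhd x ∩ U.nhd p) :
    U.pathClass x hq = U.pathClass x hp ≫ U.pathClass p hq' := by
  have hs := (U.isPathConnected x).joinedIn x (mem_of_mem_nhds (U.mem_nhds x)) p hp
  -- The path `γ` lies in both neighbourhoods, so it represents the class based at `p` and also
  -- extends a path from `x` without leaving `U.nhd x`. It has to be given, since the intersection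
  -- need not be path connected.
  rw [U.pathClass_eq hq' γ fun t => (hγ t).2, U.pathClass_eq hp hs.somePath hs.somePath_mem,
    U.pathClass_eq hq (hs.somePath.trans γ) (Path.mem_of_trans hs.somePath_mem fun t => (hγ t).1)]
  rfl

end OneConnectedNhds

/-! ### Local path connectedness. -/

namespace LocallyRelativelyOneConnected

variable {X : Type u} [TopologicalSpace X]

/-- A path connected neighbourhood inside `N` joins `x` to all of its points. The resulting paths
feed `pathClass_comp` and `transport_eq_frame`. -/
theorem eventually_joinedIn (hX : LocallyRelativelyOneConnected X) {x : X} {N : Set X}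
    (hN : N ∈ 𝓝 x) : ∀ᶠ p in 𝓝 x, JoinedIn N x p := by
  obtain ⟨W, hW, hWN, hc, _⟩ := hX x N hN
  filter_upwards [hW] with p hp
  exact (hc.joinedIn x (mem_of_mem_nhds hW) p hp).mono hWN

end LocallyRelativelyOneConnected

/-! ### Reconstruction of a local system from a functor, and its transport. -/

namespace LocalSystem

variable {X : Type u} [TopologicalSpace X] {C : Type w} [Category.{v} C]

/-- Along a path inside `U_z`, the transport is the change of frame. -/
theorem frame_transport (L : LocalSystem X C) (z : X) {x y : X} (γ : Path x y)
    (hγ : ∀ t, γ t ∈ L.nhd z) (hx : x ∈ L.nhd z) (hy : y ∈ L.nhd z) :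
    (L.frame z hx).hom ≫ (L.transport γ).hom = (L.frame z hy).hom := by
  -- The frames from `z` form a parallel family along `γ`, so transport carries the one at the
  -- source to the one at the target.
  have h := L.transport_eq γ (fun t => (L.frame z (hγ t)).hom) (fun t => by
    filter_upwards [γ.continuous.continuousAt (L.eventually_frame z (γ t) (hγ t))] with s hs h
    exact congrArg Iso.hom (hs (hγ s) h))
  -- The endpoints `γ 0` and `γ 1` equal `x` and `y` only propositionally; this absorbs the
  -- `eqToHom` factors into the frames.
  have key : ∀ {p q : X} (h : p = q) (hp : p ∈ L.nhd z) (hq : q ∈ L.nhd z),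
      (L.frame z hp).hom ≫ eqToHom (congrArg L.obj h) = (L.frame z hq).hom := by
    rintro p _ rfl _ _; simp
  rwa [key γ.source _ hx, key γ.target _ hy] at h

/-- In `frame_transport` with `z = x` the first frame is the identity. This is what recovers the
frames of `L` from its monodromy. -/
theorem transport_eq_frame (L : LocalSystem X C) {x y : X} (γ : Path x y)
    (hγ : ∀ t, γ t ∈ L.nhd x) (hy : y ∈ L.nhd x) :
    L.transport γ = L.frame x hy := by
  ext
  rw [← L.frame_transport x γ hγ (L.mem_nhd x) hy, frame_self]
  simp

variable (hX : LocallyRelativelyOneConnected X) (U : OneConnectedNhds X)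

/-- The local system with a given monodromy. -/
noncomputable def ofFunctor (F : FundamentalGroupoid X ⥤ C) : LocalSystem X C :=
  -- The cover must be open, which the chosen neighbourhoods need not be. Interiors may fail to be
  -- path connected, so path classes are still taken in `U.nhd x`.
  ofFrame (fun x => ⟨interior (U.nhd x), isOpen_interior⟩)
    (fun x => mem_interior_iff_mem_nhds.2 (U.mem_nhds x)) (fun x => F.obj ⟨x⟩)
    (fun x _ hp => F.mapIso (asIso (U.pathClass x (interior_subset hp)))) (fun x p hp => by
      -- Since `p` is interior to `U.nhd x`, the intersection with `U.nhd p` is a neighbourhood of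
      -- `p`, and nearby points can be joined to `p` inside it.
      filter_upwards [hX.eventually_joinedIn (Filter.inter_mem (mem_interior_iff_mem_nhds.1 hp)
        (U.mem_nhds p))] with q hq h h'
      ext
      simp [U.pathClass_comp (interior_subset hp) (interior_subset h) (interior_subset h')
        hq.somePath hq.somePath_mem])

theorem ofFunctor_frame (F : FundamentalGroupoid X ⥤ C) {x p : X}
    (hp : p ∈ (ofFunctor hX U F).nhd x) :
    ((ofFunctor hX U F).frame x hp).hom = F.map (U.pathClass x (interior_subset hp)) :=
  congrArg Iso.hom (ofFrame_frame ..)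

/-- A functor on the Poincaré groupoid is the monodromy of the associated local system. -/
theorem ofFunctor_transport (F : FundamentalGroupoid X ⥤ C) {x y : X} (γ : Path x y) :
    ((ofFunctor hX U F).transport γ).hom =
      F.map (X := ⟨x⟩) (Y := ⟨y⟩) (Path.Homotopic.Quotient.mk γ) := by
  -- Both properties of the interval are used: contractibility makes `u s t` below independent of
  -- the path from `s` to `t`, and local path connectedness makes the family `F.map (u 0 t)`
  -- parallel.
  have := (convex_Icc (0 : ℝ) 1).locallyPathConnectedSpace
  have := (convex_Icc (0 : ℝ) 1).contractibleSpace ⟨0, by simp⟩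
  let u : ∀ s t : unitInterval, FundamentalGroupoid.mk (γ s) ⟶ FundamentalGroupoid.mk (γ t) :=
    fun s t => Path.Homotopic.Quotient.mk ((PathConnectedSpace.somePath s t).map γ.continuous)
  have hu : ∀ {s t : unitInterval} (δ : Path s t),
      u s t = Path.Homotopic.Quotient.mk (δ.map γ.continuous) := fun δ =>
    Quotient.sound ((SimplyConnectedSpace.paths_homotopic _ δ).map γ.toContinuousMap)
  have hu_comp : ∀ r s t, u r t = u r s ≫ u s t := fun r s t => by
    rw [hu (.trans (PathConnectedSpace.somePath r s) (PathConnectedSpace.somePath s t)),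
      Path.map_trans]
    rfl
  have hu_self : ∀ t, u t t = 𝟙 _ := fun t => hu (.refl t)
  have key := (ofFunctor hX U F).transport_eq γ (A := F.obj ⟨γ 0⟩)
    (fun t => F.map (u 0 t)) (fun t => by
      -- For `s` near `t` there is a path from `t` to `s` whose image under `γ` stays in the
      -- neighbourhood of `γ t`. Hence `u t s` is the class defining the frame there, and `u 0 s = u
      -- 0 t ≫ u t s` is the parallel condition.
      have hN := γ.continuous.continuousAt.preimage_mem_nhds (U.mem_nhds (γ t))
      filter_upwards [pathComponentIn_mem_nhds hN] with s hs h
      have hs : JoinedIn _ t s := hs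
      refine Eq.trans ?_ (congrArg (F.map (u 0 t) ≫ ·)
        (ofFunctor_frame hX U F (x := γ t) (p := γ s) h).symm)
      rw [hu_comp 0 t s, F.map_comp, hu hs.somePath,
        U.pathClass_eq _ (hs.somePath.map γ.continuous) hs.somePath_mem]
      rfl)
  have h1 : u 0 1 = eqToHom (congrArg FundamentalGroupoid.mk γ.source) ≫
      (show FundamentalGroupoid.mk x ⟶ ⟨y⟩ from Path.Homotopic.Quotient.mk γ) ≫
        eqToHom (congrArg FundamentalGroupoid.mk γ.target.symm) := by
    -- The identity of the interval, viewed as a path from 0 to 1, computes `u 0 1`; its image under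
    -- `γ` is `γ` itself, up to the names of the endpoints.
    rw [FundamentalGroupoid.conj_eqToHom γ.source γ.target, hu (s := 0) (t := 1) ⟨.id _, rfl, rfl⟩]
    rfl
  have he : ∀ {p q : X} (h : p = q), eqToHom (congrArg (ofFunctor hX U F).obj h) =
      F.map (eqToHom (congrArg FundamentalGroupoid.mk h)) := by
    rintro p _ rfl; exact (F.map_id _).symm
  rw [hu_self, F.map_id, h1, he γ.source, he γ.target] at key
  have key2 : F.map (eqToHom (congrArg FundamentalGroupoid.mk γ.source)) ≫
      ((ofFunctor hX U F).transport γ).hom = _ :=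
    (congrArg (· ≫ ((ofFunctor hX U F).transport γ).hom) (Category.id_comp _)).symm.trans key
  -- The correction at the source is an isomorphism and cancels; the two corrections at the target
  -- are mutually inverse.
  refine (cancel_epi (F.map (eqToHom (congrArg FundamentalGroupoid.mk γ.source)))).1
    (key2.trans ?_)
  exact (F.map_comp _ _).symm.trans ((congrArg F.map (by simp)).trans (F.map_comp _ _))

end LocalSystem

/-! ### The monodromy equivalence for a fixed coefficient category. -/

namespace LocalSystem

variable {X : Type u} [TopologicalSpace X] (C : Type w) [Category.{v} C]
  (hX : LocallyRelativelyOneConnected X) (U : OneConnectedNhds X)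

/-- The quasi-inverse of the monodromy functor. -/
noncomputable def ofFunctorFunctor : (FundamentalGroupoid X ⥤ C) ⥤ LocalSystem X C where
  obj := ofFunctor hX U
  -- Both local systems use the same path classes for their frames, so compatibility is naturality
  -- of `α` and holds on the whole neighbourhood.
  map {F G} α := ⟨fun x => α.app ⟨x⟩, fun x => .of_forall fun p h h' => by
    rw [ofFunctor_frame, ofFunctor_frame]
    exact α.naturality _⟩
  map_id _ := rfl
  map_comp _ _ := rfl

variable {C} in
/-- A local system is recovered from its monodromy. -/
noncomputable def isoOfFunctorMonodromy (L : LocalSystem X C) :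
    L ≅ ofFunctor hX U ((monodromy X C).obj L) :=
  isoMk (L' := ofFunctor hX U ((monodromy X C).obj L)) (fun x => Iso.refl (L.obj x)) fun x => by
    -- A path to `p` inside both neighbourhoods of `x` serves twice: it represents `pathClass`, and
    -- the transport of `L` along it is the frame of `L`.
    filter_upwards [hX.eventually_joinedIn (Filter.inter_mem
      ((L.nhd x).isOpen.mem_nhds (L.mem_nhd x)) (U.mem_nhds x))] with p hp h h'
    refine (Category.comp_id _).trans (Eq.trans ?_ (Category.id_comp _).symm)
    rw [ofFunctor_frame, U.pathClass_eq _ hp.somePath fun t => (hp.somePath_mem t).2,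
      ← L.transport_eq_frame hp.somePath (fun t => (hp.somePath_mem t).1) h]
    rfl

/-- The unit of the monodromy equivalence. -/
noncomputable def monodromyUnitIso :
    𝟭 (LocalSystem X C) ≅ monodromy X C ⋙ ofFunctorFunctor C hX U :=
  NatIso.ofComponents (fun L => isoOfFunctorMonodromy hX U L)
    (fun φ => hom_ext fun x => (Category.comp_id (φ.app x)).trans (Category.id_comp _).symm)

variable {C} in
/-- The monodromy of the local system associated to a functor. -/
noncomputable def monodromyOfFunctorIso (F : FundamentalGroupoid X ⥤ C) :
    (monodromy X C).obj (ofFunctor hX U F) ≅ F :=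
  NatIso.ofComponents (fun x => Iso.refl (F.obj x)) (fun {x y} γ => by
    obtain ⟨γ⟩ := γ
    refine (Category.comp_id _).trans (Eq.trans ?_ (Category.id_comp _).symm)
    exact ofFunctor_transport hX U F γ)

/-- The counit of the monodromy equivalence. -/
noncomputable def monodromyCounitIso :
    ofFunctorFunctor C hX U ⋙ monodromy X C ≅ 𝟭 (FundamentalGroupoid X ⥤ C) :=
  NatIso.ofComponents (fun F => monodromyOfFunctorIso hX U F)
    (fun α => NatTrans.ext (funext fun x =>
      (Category.comp_id (α.app x)).trans (Category.id_comp _).symm))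

theorem monodromy_isEquivalence (hX : LocallyRelativelyOneConnected X) :
    (monodromy X C).IsEquivalence := by
  obtain ⟨U⟩ := OneConnectedNhds.nonempty_of_locallyRelativelyOneConnected hX
  exact (CategoryTheory.Equivalence.mk (monodromy X C) (ofFunctorFunctor C hX U)
    (monodromyUnitIso C hX U) (monodromyCounitIso C hX U)).isEquivalence_functor

variable {C} in
/-- The quasi-inverse of the monodromy functor commutes with change of coefficients. -/
noncomputable def ofFunctorMapCoeff {D : Type w'} [Category.{v'} D] (F : C ⥤ D) :
    (Functor.whiskeringRight (FundamentalGroupoid X) C D).obj F ⋙ ofFunctorFunctor D hX U ≅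
      ofFunctorFunctor C hX U ⋙ mapCoeff X F :=
  NatIso.ofComponents
    (fun M => isoMk (L := ofFunctor hX U (M ⋙ F)) (L' := (mapCoeff X F).obj (ofFunctor hX U M))
      (fun x => Iso.refl (F.obj (M.obj ⟨x⟩))) fun x => .of_forall fun p h h' => by
        refine (Category.comp_id _).trans (Eq.trans ?_ (Category.id_comp _).symm)
        rw [ofFunctor_frame]
        exact congrArg F.map (ofFunctor_frame hX U M h').symm)
    (fun {M N} α => hom_ext fun x =>
      (Category.comp_id (F.map (α.app ⟨x⟩))).trans (Category.id_comp _).symm)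

end LocalSystem

/-! ### The equivalence of 2-functors. -/

section TwoFunctors

open Bicategory LocalSystem
open scoped Pseudofunctor.StrongTrans

variable {X : Type u} [TopologicalSpace X]
  (hX : LocallyRelativelyOneConnected X) (U : OneConnectedNhds X)

/-- The quasi-inverse of the monodromy 2-transformation. -/
noncomputable def ofFunctorTransformation :
    Pseudofunctor.StrongTrans (representations.{v, w} X) (globalSections.{v, w} X) where
  app C := (ofFunctorFunctor C hX U).toCatHom
  naturality {C D} F := Cat.Hom.isoMk (ofFunctorMapCoeff hX U F.toFunctor)
  naturality_naturality {a b f g} η := by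
    refine Cat.Hom₂.ext (NatTrans.ext (funext fun M => hom_ext fun x => ?_))
    let c : a := Functor.obj M ⟨x⟩
    change η.toNatTrans.app c ≫ 𝟙 (g.toFunctor.obj c) = 𝟙 (f.toFunctor.obj c) ≫ η.toNatTrans.app c
    simp
  naturality_id C := by
    refine Cat.Hom₂.ext (NatTrans.ext (funext fun M => hom_ext fun x => ?_))
    let c : C := Functor.obj M ⟨x⟩
    change 𝟙 c ≫ 𝟙 c = 𝟙 c ≫ 𝟙 c ≫ 𝟙 c
    simp
  naturality_comp F G := by
    refine Cat.Hom₂.ext (NatTrans.ext (funext fun M => hom_ext fun x => ?_))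
    let d := G.toFunctor.obj (F.toFunctor.obj (Functor.obj M ⟨x⟩))
    change 𝟙 d ≫ 𝟙 d = 𝟙 d ≫ 𝟙 d ≫ 𝟙 d ≫ 𝟙 d ≫
      G.toFunctor.map (𝟙 (F.toFunctor.obj (Functor.obj M ⟨x⟩))) ≫ 𝟙 d
    simp [d]

/-- A single choice of `U` serves all coefficient categories, so the quasi-inverses form a
2-transformation, and the units and counits become invertible modifications. -/
theorem monodromyTransformation_isTwoEquivalence (hX : LocallyRelativelyOneConnected X) :
    IsTwoEquivalence (monodromyTransformation.{v, w} X) := by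
  obtain ⟨U⟩ := OneConnectedNhds.nonempty_of_locallyRelativelyOneConnected hX
  refine ⟨ofFunctorTransformation hX U, ⟨?_⟩, ⟨?_⟩⟩
  · refine Pseudofunctor.StrongTrans.isoMk
      (fun C => Cat.Hom.isoMk (monodromyUnitIso C hX U).symm) fun {C D} F => ?_
    refine Cat.Hom₂.ext (NatTrans.ext (funext fun L => hom_ext fun x => ?_))
    -- On the stalk at `x`, every structural 2-cell in the modification axiom is an identity or the
    -- image of one under `F`.
    let d := F.toFunctor.obj (LocalSystem.obj L x)
    change 𝟙 d ≫ 𝟙 d ≫ 𝟙 d = (𝟙 d ≫ 𝟙 d ≫ 𝟙 d ≫ 𝟙 d ≫ 𝟙 d) ≫ F.toFunctor.map (𝟙 (LocalSystem.obj L x))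
    simp [d]
  · refine Pseudofunctor.StrongTrans.isoMk
      (fun C => Cat.Hom.isoMk (monodromyCounitIso C hX U)) fun {C D} F => ?_
    refine Cat.Hom₂.ext (NatTrans.ext (funext fun M => NatTrans.ext (funext fun x => ?_)))
    let d := F.toFunctor.obj (Functor.obj M x)
    change 𝟙 d ≫ 𝟙 d ≫ 𝟙 d = (𝟙 d ≫ 𝟙 d ≫ 𝟙 d ≫ 𝟙 d ≫ 𝟙 d) ≫ F.toFunctor.map (𝟙 (Functor.obj M x))
    simp [d]

end TwoFunctors

theorem mainTheorem2 (X : Type u) [TopologicalSpace X] (hX : LocallyRelativelyOneConnected X) :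
    (∀ (C : Type w) [Category.{v} C], (LocalSystem.monodromy X C).IsEquivalence) ∧
      IsTwoEquivalence (monodromyTransformation.{v, w} X) :=
  ⟨fun C _ => LocalSystem.monodromy_isEquivalence C hX,
    monodromyTransformation_isTwoEquivalence hX⟩
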